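/- Let $F$ be an arbitrary field (of any characteristic), let $n$ be a non-negative integer, and let $A \in M_n(F)$ be an $n \times n$ matrix over $F$. Then there exist matrices $S_1, S_2, S_3, S_4 \in M_n(F)$ with $S_i^2 = 0$ for $i = 1,2,3,4$ and $A = S_1 + S_2 + S_3 + S_4$ if and only if $\operatorname{tr} A = 0$. -/

import Mathlib

/-!
A square-zero matrix is nilpotent, so its trace vanishes; this is the easy implication. For the
converse, let `A` have trace zero.

If `A` is not a scalar matrix, then `A` is a sum of two nilpotent matrices
(`Matrix.isSumTwoNilpotent_of_trace_eq_zero`). Indeed some vector `x` is linearly independent of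
`A x`, and in a basis consisting of `x` and a basis of a hyperplane through `A x` missing `x`,
the matrix becomes `[0, B; C, D]` with `C ≠ 0`. If `D = L + U` with `L` and `U` nilpotent, then
`[0, B; C, D] = [0, 0; C, L] + [0, B; 0, U]` is again a sum of two nilpotents, so one can induct on
the size. The induction could only fail when `D` is a nonzero scalar matrix, but then a conjugation
by a transvection `[1, w; 0, 1]` with `w C = 0` makes the lower right block non-scalar.

Each nilpotent matrix is in turn a sum of two square-zero matrices
(`Matrix.isSumTwoSqZero_of_isNilpotent`). It makes the space a module over `F[X]` that is a direct
sum of modules `F[X] ⧸ (X ^ k)`, and on each of these multiplication by `X` is the sum of the map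
that raises even powers of `X` and kills odd ones, and the map that does the opposite.

If `A = μ • 1` with `μ ≠ 0`, then `n = 0` in `F` (`Matrix.isSumFourSqZero_smul_one`). In
characteristic two, `n` is even and `A` is a sum of three square-zero block matrices. Otherwise,
index the rows by `ZMod n` and put `D = diag (μ i)`. The involutions `i ↦ -i` and `i ↦ 2 - i` of
`ZMod n` conjugate `D` to `-D` and `μ - D` to `-(μ - D)`, respectively, and an element `D` that
anticommutes with an involution `P` is the sum of the square-zero elements `(D ± D P) / 2`
(`isSumTwoSqZero_of_anticommute`).
-/

/-! ### Nilpotent matrices are sums of two square-zero matrices -/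

open Polynomial in
/-- The linear endomorphism of `F[X]` sending `X ^ n` to `X ^ (n + 1)` if `n` is even, and to `0` if
`n` is odd. -/
noncomputable def Polynomial.evenShift (F : Type*) [Field F] : F[X] →ₗ[F] F[X] :=
  (Polynomial.basisMonomials F).constr F fun n => if Even n then monomial (n + 1) 1 else 0

open Polynomial in
theorem Polynomial.evenShift_monomial {F : Type*} [Field F] (n : ℕ) (a : F) :
    evenShift F (monomial n a) = if Even n then monomial (n + 1) a else 0 := by
  have h : monomial n a = a • (basisMonomials F n) := by simp [smul_monomial]
  rw [h, map_smul, evenShift, Module.Basis.constr_basis]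
  split_ifs <;> simp [smul_monomial]

open Polynomial in
theorem Polynomial.evenShift_evenShift {F : Type*} [Field F] (p : F[X]) :
    evenShift F (evenShift F p) = 0 := by
  induction p using Polynomial.induction_on' with
  | add p q hp hq => simp [hp, hq]
  | monomial n a =>
    rw [evenShift_monomial]
    split_ifs with h
    · rw [evenShift_monomial, if_neg (by grind)]
    · simp

open Polynomial in
/-- The difference of multiplication by `X` and `evenShift` shifts odd powers and kills even ones,
so it has square zero as well. -/
theorem Polynomial.X_mul_sub_evenShift_sq {F : Type*} [Field F] (p : F[X]) :
    X * (X * p - evenShift F p) - evenShift F (X * p - evenShift F p) = 0 := by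
  induction p using Polynomial.induction_on' with
  | add p q hp hq =>
    have := congrArg₂ (· + ·) hp hq
    simp only [add_zero] at this
    rw [← this]
    simp only [mul_add, map_add, mul_sub, map_sub]
    ring
  | monomial n a =>
    simp only [map_sub, X_mul_monomial, evenShift_monomial]
    split_ifs <;> first | grind | simp [evenShift_monomial, *]

open Polynomial in
theorem Polynomial.X_pow_dvd_evenShift {F : Type*} [Field F] {p : F[X]} {k : ℕ}
    (h : X ^ k ∣ p) : X ^ k ∣ evenShift F p := by
  have hc (q : F[X]) (m : ℕ) :
      (evenShift F q).coeff (m + 1) = if Even m then q.coeff m else 0 := by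
    induction q using Polynomial.induction_on' with
    | add p q hp hq => rw [map_add, coeff_add, hp, hq]; split_ifs <;> simp
    | monomial n a =>
      rw [evenShift_monomial]
      split_ifs <;> simp [coeff_monomial] <;> grind
  have h0 (q : F[X]) : (evenShift F q).coeff 0 = 0 := by
    induction q using Polynomial.induction_on' with
    | add p q hp hq => simp [hp, hq]
    | monomial n a => rw [evenShift_monomial]; split_ifs <;> simp [coeff_monomial]
  rw [X_pow_dvd_iff] at h ⊢
  rintro (_ | m) hm
  · exact h0 p
  · rw [hc, h m (by omega), ite_self]

open Polynomial in
/-- Multiplication by `X` on the `F[X]`-module `M` is a sum `S + (X - S)` of two `F`-linear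
endomorphisms of square zero. -/
def XSplits (F M : Type*) [Field F] [AddCommGroup M] [Module F M] [Module F[X] M] : Prop :=
  ∃ S : M →ₗ[F] M, (∀ m, S (S m) = 0) ∧
    ∀ m, (X : F[X]) • ((X : F[X]) • m - S m) - S ((X : F[X]) • m - S m) = 0

open Polynomial in
theorem xSplits_quotient (F : Type*) [Field F] (k : ℕ) :
    XSplits F (F[X] ⧸ Submodule.span F[X] {(X : F[X]) ^ k}) := by
  let I : Submodule F[X] F[X] := Submodule.span F[X] {(X : F[X]) ^ k}
  have hI : I.restrictScalars F ≤ (I.restrictScalars F).comap (evenShift F) := by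
    intro p hp
    rw [Submodule.mem_comap, Submodule.restrictScalars_mem] at *
    exact Ideal.mem_span_singleton.2 (X_pow_dvd_evenShift (Ideal.mem_span_singleton.1 hp))
  refine ⟨(I.restrictScalars F).mapQ (I.restrictScalars F) (evenShift F) hI, ?_, ?_⟩
  · intro m
    obtain ⟨p, rfl⟩ := Submodule.Quotient.mk_surjective _ m
    exact congrArg (Submodule.Quotient.mk (p := I)) (evenShift_evenShift p)
  · intro m
    obtain ⟨p, rfl⟩ := Submodule.Quotient.mk_surjective _ m
    exact congrArg (Submodule.Quotient.mk (p := I)) (X_mul_sub_evenShift_sq p)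

open Polynomial in
theorem XSplits.directSum {F ι : Type*} [Field F] {M : ι → Type*} [∀ i, AddCommGroup (M i)]
    [∀ i, Module F (M i)] [∀ i, Module F[X] (M i)] (h : ∀ i, XSplits F (M i)) :
    XSplits F (DirectSum ι M) := by
  choose S hS hS' using h
  refine ⟨DirectSum.lmap S, fun m => ?_, fun m => ?_⟩
  · ext i : 1
    exact hS i (m i)
  · ext i : 1
    exact hS' i (m i)

open Polynomial in
theorem XSplits.of_linearEquiv {F M N : Type*} [Field F] [AddCommGroup M] [Module F M]
    [Module F[X] M] [IsScalarTower F F[X] M] [AddCommGroup N] [Module F N] [Module F[X] N]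
    [IsScalarTower F F[X] N] (e : M ≃ₗ[F[X]] N) (h : XSplits F N) : XSplits F M := by
  obtain ⟨S, hS, hS'⟩ := h
  let e' := e.restrictScalars F
  have he (m) : e' m = e m := rfl
  refine ⟨e'.symm ∘ₗ S ∘ₗ e', fun m => ?_, fun m => ?_⟩
  · simp [hS]
  · apply e.injective
    have := hS' (e m)
    have h2 (n) : e (e'.symm n) = n := e'.apply_symm_apply n
    simpa [h2, he] using this

/-- `x` is a sum of two elements whose squares vanish. -/
def IsSumTwoSqZero {R : Type*} [Ring R] (x : R) : Prop :=
  ∃ a b : R, a ^ 2 = 0 ∧ b ^ 2 = 0 ∧ x = a + b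

/-- `x` is a sum of two nilpotent elements. -/
def IsSumTwoNilpotent {R : Type*} [Ring R] (x : R) : Prop :=
  ∃ a b : R, IsNilpotent a ∧ IsNilpotent b ∧ x = a + b

/-- `x` is a sum of four elements whose squares vanish. -/
def IsSumFourSqZero {R : Type*} [Ring R] (x : R) : Prop :=
  ∃ a b c d : R, a ^ 2 = 0 ∧ b ^ 2 = 0 ∧ c ^ 2 = 0 ∧ d ^ 2 = 0 ∧ x = a + b + c + d

theorem IsSumTwoSqZero.map {R R' : Type*} [Ring R] [Ring R'] {x : R} (h : IsSumTwoSqZero x)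
    (f : R →+* R') : IsSumTwoSqZero (f x) := by
  obtain ⟨a, b, ha, hb, rfl⟩ := h
  exact ⟨f a, f b, by rw [← map_pow, ha, map_zero], by rw [← map_pow, hb, map_zero], map_add f a b⟩

theorem IsSumTwoNilpotent.map {R R' : Type*} [Ring R] [Ring R'] {x : R} (h : IsSumTwoNilpotent x)
    (f : R →+* R') : IsSumTwoNilpotent (f x) := by
  obtain ⟨a, b, ha, hb, rfl⟩ := h
  exact ⟨f a, f b, ha.map f, hb.map f, map_add f a b⟩

theorem IsSumFourSqZero.map {R R' : Type*} [Ring R] [Ring R'] {x : R} (h : IsSumFourSqZero x)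
    (f : R →+* R') : IsSumFourSqZero (f x) := by
  obtain ⟨a, b, c, d, ha, hb, hc, hd, rfl⟩ := h
  have hf {y : R} (hy : y ^ 2 = 0) : f y ^ 2 = 0 := by rw [← map_pow, hy, map_zero]
  exact ⟨f a, f b, f c, f d, hf ha, hf hb, hf hc, hf hd, by simp⟩

theorem IsSumTwoSqZero.add {R : Type*} [Ring R] {x y : R} (hx : IsSumTwoSqZero x)
    (hy : IsSumTwoSqZero y) : IsSumFourSqZero (x + y) := by
  obtain ⟨a, b, ha, hb, rfl⟩ := hx
  obtain ⟨c, d, hc, hd, rfl⟩ := hy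
  exact ⟨a, b, c, d, ha, hb, hc, hd, (add_assoc _ _ _).symm⟩

open Polynomial in
theorem Module.End.isSumTwoSqZero_of_isNilpotent {F V : Type*} [Field F] [AddCommGroup V]
    [Module F V] [FiniteDimensional F V] {f : Module.End F V} (hf : IsNilpotent f) :
    IsSumTwoSqZero f := by
  have hM : Module.IsTorsion' (Module.AEval' f) (Submonoid.powers (X : F[X])) := by
    obtain ⟨k, hk⟩ := hf
    intro m
    refine ⟨⟨X ^ k, k, rfl⟩, ?_⟩
    obtain ⟨v, rfl⟩ := (Module.AEval'.of f).surjective m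
    change (X ^ k : F[X]) • Module.AEval'.of f v = 0
    rw [Module.AEval'.X_pow_smul_of, hk]
    simp
  obtain ⟨d, k, ⟨e⟩⟩ := Module.torsion_by_prime_power_decomposition irreducible_X hM
  obtain ⟨S, hS, hS'⟩ := XSplits.of_linearEquiv e
    (XSplits.directSum fun i => xSplits_quotient F (k i))
  let o := Module.AEval'.of f
  let T : Module.End F V := o.symm.toLinearMap ∘ₗ S ∘ₗ o.toLinearMap
  have hT (v) : o (T v) = S (o v) := by simp [T]
  refine ⟨T, f - T, ?_, ?_, by abel⟩
  · ext v
    apply o.injective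
    simp [pow_two, hT, hS]
  · ext v
    apply o.injective
    have := hS' (o v)
    rw [Module.AEval'.X_smul_of, ← hT, ← map_sub, Module.AEval'.X_smul_of, ← hT, ← map_sub] at this
    simpa [pow_two] using this

theorem Matrix.isSumTwoSqZero_of_isNilpotent {F ι : Type*} [Field F] [Fintype ι] [DecidableEq ι]
    {A : Matrix ι ι F} (hA : IsNilpotent A) : IsSumTwoSqZero A := by
  have h := Module.End.isSumTwoSqZero_of_isNilpotent (hA.map (Matrix.toLinAlgEquiv' (R := F)))
  simpa using h.map (LinearMap.toMatrixAlgEquiv' (R := F) (n := ι)).toAlgHom.toRingHom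

/-! ### Non-scalar matrices of trace zero are sums of two nilpotent matrices -/

theorem Matrix.isNilpotent_fromBlocks_upper {R m n : Type*} [CommRing R] [Fintype m] [Fintype n]
    [DecidableEq m] [DecidableEq n] (B : Matrix m n R) {N : Matrix n n R} (hN : IsNilpotent N) :
    IsNilpotent (fromBlocks 0 B 0 N : Matrix (m ⊕ n) (m ⊕ n) R) := by
  obtain ⟨k, hk⟩ := hN
  have h (j : ℕ) : (fromBlocks 0 B 0 N : Matrix (m ⊕ n) (m ⊕ n) R) ^ (j + 1) =
      fromBlocks 0 (B * N ^ j) 0 (N ^ (j + 1)) := by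
    induction j with
    | zero => simp
    | succ j ih => rw [pow_succ, ih, fromBlocks_multiply]; simp [pow_succ, Matrix.mul_assoc]
  exact ⟨k + 1, by rw [h, pow_succ, hk]; simp⟩

theorem Matrix.isNilpotent_fromBlocks_lower {R m n : Type*} [CommRing R] [Fintype m] [Fintype n]
    [DecidableEq m] [DecidableEq n] (C : Matrix n m R) {N : Matrix n n R} (hN : IsNilpotent N) :
    IsNilpotent (fromBlocks 0 0 C N : Matrix (m ⊕ n) (m ⊕ n) R) := by
  have h := isNilpotent_fromBlocks_upper C.transpose ((isNilpotent_transpose_iff).2 hN)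
  rw [← isNilpotent_transpose_iff, fromBlocks_transpose]
  simpa using h

theorem IsSumTwoNilpotent.fromBlocks {R m n : Type*} [CommRing R] [Fintype m] [Fintype n]
    [DecidableEq m] [DecidableEq n] (B : Matrix m n R) (C : Matrix n m R) {D : Matrix n n R}
    (hD : IsSumTwoNilpotent D) :
    IsSumTwoNilpotent (Matrix.fromBlocks 0 B C D : Matrix (m ⊕ n) (m ⊕ n) R) := by
  obtain ⟨N, N', hN, hN', rfl⟩ := hD
  exact ⟨_, _, Matrix.isNilpotent_fromBlocks_upper B hN, Matrix.isNilpotent_fromBlocks_lower C hN',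
    by simp [Matrix.fromBlocks_add]⟩

/-- The equivalence `Fin (n + 1) ≃ Unit ⊕ Fin n` that splits off the index `0`. -/
def Fin.equivUnitSum (n : ℕ) : Fin (n + 1) ≃ Unit ⊕ Fin n where
  toFun := Fin.cases (Sum.inl ()) Sum.inr
  invFun := Sum.elim (fun _ => 0) Fin.succ
  left_inv i := by cases i using Fin.cases <;> rfl
  right_inv i := by rcases i with _ | i <;> rfl

/-- A non-scalar matrix is similar to one whose first diagonal entry is zero and whose first column
is not. The change of basis and the passage to blocks are recorded as one algebra isomorphism `e`. -/
theorem Matrix.exists_algEquiv_fromBlocks {F : Type*} [Field F] {n : ℕ}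
    {A : Matrix (Fin (n + 1)) (Fin (n + 1)) F} (hA : ∀ μ : F, A ≠ μ • 1) :
    ∃ (e : Matrix (Fin (n + 1)) (Fin (n + 1)) F ≃ₐ[F] Matrix (Unit ⊕ Fin n) (Unit ⊕ Fin n) F)
      (B : Matrix Unit (Fin n) F) (C : Matrix (Fin n) Unit F) (D : Matrix (Fin n) (Fin n) F),
      C ≠ 0 ∧ D.trace = A.trace ∧ e A = fromBlocks 0 B C D := by
  let f : Module.End F (Fin (n + 1) → F) := Matrix.toLin' A
  obtain ⟨x, hx⟩ : ∃ x, LinearIndependent F ![x, f x] := by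
    by_contra! h
    obtain ⟨μ, hμ⟩ := LinearMap.exists_eq_smul_id_of_forall_notLinearIndependent h
    apply hA μ
    apply (Matrix.toLin' (R := F)).injective
    refine (show f = _ from hμ).trans ?_
    ext; simp
  have hxp : x ∉ Submodule.span F {f x} := by
    intro h
    obtain ⟨c, hc⟩ := Submodule.mem_span_singleton.1 h
    have := LinearIndependent.pair_iff.1 hx 1 (-c) (by simp [hc])
    simp at this
  obtain ⟨φ, hφ, hφp⟩ := Submodule.exists_dual_map_eq_bot_of_notMem hxp inferInstance
  have hfx : φ (f x) = 0 := by
    have : φ (f x) ∈ (Submodule.span F {f x}).map φ :=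
      Submodule.mem_map_of_mem (Submodule.mem_span_singleton_self _)
    simpa [hφp] using this
  have hfx0 : f x ≠ 0 := by simpa using hx.ne_zero 1
  have hrank : Module.finrank F (LinearMap.ker φ) = n := by
    have h1 := φ.finrank_range_add_finrank_ker
    have h2 : LinearMap.range φ = ⊤ := LinearMap.range_eq_top.2
      (LinearMap.surjective fun h => hφ (by simp [h]))
    rw [h2] at h1
    simp at h1
    omega
  -- `x` followed by a basis of the hyperplane `ker φ`, which contains `f x` but not `x`.
  let b := Module.Basis.mkFinCons x (Module.finBasisOfFinrankEq F (LinearMap.ker φ) hrank)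
    (fun c y hy h => by
      have := congrArg φ h
      rw [LinearMap.mem_ker] at hy
      simpa [hy, hφ] using this)
    (fun z => ⟨-(φ z / φ x), by simp [hφ]⟩)
  have hb0 : b 0 = x := by simp [b]
  have hbs (i : Fin n) : φ (b i.succ) = 0 := by simp [b]
  let M := LinearMap.toMatrixAlgEquiv b f
  have hM0 (i) : M i 0 = b.repr (f x) i := by simp [M, LinearMap.toMatrixAlgEquiv_apply, hb0]
  have hM00 : M 0 0 = 0 := by
    have h := congrArg φ (b.sum_repr (f x))
    rw [Fin.sum_univ_succ] at h
    simpa [hbs, hb0, hfx, hφ, ← hM0] using h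
  have htr : M.trace = A.trace := by
    have h1 := LinearMap.trace_eq_matrix_trace F b f
    rw [Matrix.trace_toLin'_eq] at h1
    exact h1.symm
  let M' := M.submatrix (Fin.equivUnitSum n).symm (Fin.equivUnitSum n).symm
  refine ⟨(Matrix.toLinAlgEquiv'.trans (LinearMap.toMatrixAlgEquiv b)).trans
    (Matrix.reindexAlgEquiv F F (Fin.equivUnitSum n)), M'.toBlocks₁₂, M'.toBlocks₂₁, M'.toBlocks₂₂,
    ?_, ?_, ?_⟩
  · intro h
    apply hfx0
    apply b.repr.injective
    ext i
    rw [← hM0]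
    cases i using Fin.cases with
    | zero => simpa using hM00
    | succ i => exact (congrFun (congrFun h i) ()).trans (by simp)
  · rw [← htr, Matrix.trace, Matrix.trace, Fin.sum_univ_succ, diag_apply, hM00, zero_add]
    rfl
  · have h : M'.toBlocks₁₁ = 0 := by
      ext i j
      exact hM00
    rw [← h, fromBlocks_toBlocks]
    rfl

/-- Conjugating by `[1, w; 0, 1]` with `w * C = 0` and `w ≠ 0` subtracts the rank-one matrix `C * w`
from the lower right block; in size at least two this makes a scalar block non-scalar. -/
theorem Matrix.exists_algEquiv_fromBlocks_of_scalar {F m : Type*} [Field F] [Fintype m]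
    [DecidableEq m] [Nontrivial m] (B : Matrix Unit m F) {C : Matrix m Unit F} (hC : C ≠ 0)
    (μ : F) :
    ∃ (e : Matrix (Unit ⊕ m) (Unit ⊕ m) F ≃ₐ[F] Matrix (Unit ⊕ m) (Unit ⊕ m) F)
      (B' : Matrix Unit m F) (D : Matrix m m F), (∀ ν : F, D ≠ ν • 1) ∧
        D.trace = (μ • 1 : Matrix m m F).trace ∧
      e (fromBlocks 0 B C (μ • 1)) = fromBlocks 0 B' C D := by
  obtain ⟨j, hj⟩ : ∃ j, C j () ≠ 0 := by
    by_contra! h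
    exact hC (by ext i u; exact h i)
  obtain ⟨i, hij⟩ := exists_ne j
  -- The row `w` has two nonzero entries at most, chosen so that the two terms of `w * C` cancel.
  let w : Matrix Unit m F := Matrix.of fun _ => Pi.single i (C j ()) - Pi.single j (C i ())
  have hw : w * C = 0 := by
    ext
    simp [w, Matrix.mul_apply, sub_mul, Finset.sum_sub_distrib, Pi.single_apply, ite_mul]
    ring
  let P : (Matrix (Unit ⊕ m) (Unit ⊕ m) F)ˣ :=
    ⟨fromBlocks 1 w 0 1, fromBlocks 1 (-w) 0 1, by simp [fromBlocks_multiply],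
      by simp [fromBlocks_multiply]⟩
  refine ⟨MulSemiringAction.toAlgEquiv F _ (ConjAct.toConjAct P), B + μ • w, μ • 1 - C * w,
    ?_, ?_, ?_⟩
  · intro ν h
    -- The entry at `(j, i)` lies off the diagonal and equals `-(C j ()) ^ 2`.
    have := congrFun (congrFun h j) i
    simp [w, Matrix.mul_apply, hij.symm, hij, hj] at this
  · rw [trace_sub, trace_mul_comm, hw]
    simp
  · rw [MulSemiringAction.toAlgEquiv_apply, ConjAct.units_smul_def]
    simp [P, fromBlocks_multiply, hw, sub_eq_neg_add]

/-- A matrix of trace zero that is non-scalar, or zero, is a sum of two nilpotent matrices. -/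
theorem Matrix.isSumTwoNilpotent_of_trace_eq_zero {F : Type*} [Field F] {n : ℕ}
    {A : Matrix (Fin n) (Fin n) F} (htr : A.trace = 0) (hA : A = 0 ∨ ∀ μ : F, A ≠ μ • 1) :
    IsSumTwoNilpotent A := by
  have of_equiv {R R' : Type _} [Ring R] [Ring R'] [Algebra F R] [Algebra F R'] (e : R ≃ₐ[F] R')
      {x : R} (h : IsSumTwoNilpotent (e x)) : IsSumTwoNilpotent x := by
    simpa using h.map e.symm.toAlgHom.toRingHom
  induction n with
  | zero => exact ⟨0, 0, .zero, .zero, Subsingleton.elim _ _⟩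
  | succ n ih =>
    obtain rfl | hA := hA
    · exact ⟨0, 0, .zero, .zero, by simp⟩
    obtain ⟨e, B, C, D, hC, hD, he⟩ := exists_algEquiv_fromBlocks hA
    apply of_equiv e
    rw [he]
    rw [htr] at hD
    by_cases hDs : ∀ μ : F, D ≠ μ • 1
    · exact IsSumTwoNilpotent.fromBlocks B C (ih hD (.inr hDs))
    push Not at hDs
    obtain ⟨μ, rfl⟩ := hDs
    obtain hn | hn := Nat.lt_or_ge 1 n
    · have : Nontrivial (Fin n) := Fin.nontrivial_iff_two_le.2 hn
      obtain ⟨e', B', D', hD', htr', he'⟩ := exists_algEquiv_fromBlocks_of_scalar B hC μ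
      apply of_equiv e'
      rw [he']
      exact IsSumTwoNilpotent.fromBlocks B' C (ih (htr'.trans hD) (.inr hD'))
    · -- A scalar block of size at most one and trace zero vanishes.
      refine IsSumTwoNilpotent.fromBlocks B C (ih hD (.inl ?_))
      interval_cases n
      · exact Subsingleton.elim _ _
      · have : μ = 0 := by simpa using hD
        simp [this]

/-! ### Scalar matrices -/

/-- If `P` is an involution that anticommutes with `D`, then `(D + D P) / 2` and `(D - D P) / 2`
have square zero. -/
theorem isSumTwoSqZero_of_anticommute {F R : Type*} [Field F] [Ring R] [Algebra F R]
    (h2 : (2 : F) ≠ 0) {D P : R} (hP : P * P = 1) (hPD : P * D = -(D * P)) :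
    IsSumTwoSqZero D := by
  have h (Q : R) (hQ : Q * Q = 1) (hQD : Q * D = -(D * Q)) :
      ((2 : F)⁻¹ • (D + D * Q)) ^ 2 = 0 := by
    rw [pow_two, smul_mul_smul_comm, add_mul, mul_add, mul_add, mul_assoc D Q D, hQD,
      mul_assoc D Q (D * Q), ← mul_assoc Q D Q, hQD, mul_neg, neg_mul, mul_assoc D Q Q, hQ]
    simp
  refine ⟨_, _, h P hP hPD, h (-P) (by simpa) (by simp [hPD]), ?_⟩
  rw [← smul_add, mul_neg, add_add_add_comm, add_neg_cancel, add_zero, ← two_smul F D, smul_smul,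
    inv_mul_cancel₀ h2, one_smul]

theorem Matrix.isSumTwoSqZero_diagonal {F ι : Type*} [Field F] [Fintype ι] [DecidableEq ι]
    (h2 : (2 : F) ≠ 0) {d : ι → F} {σ : ι → ι} (hσ : Function.Involutive σ)
    (hd : ∀ i, d (σ i) = -d i) : IsSumTwoSqZero (diagonal d) := by
  -- `P` is the permutation matrix of `σ`.
  refine isSumTwoSqZero_of_anticommute h2 (P := (1 : Matrix ι ι F).submatrix σ id) ?_ ?_
  · ext i j
    rw [mul_apply, Finset.sum_eq_single (σ i)]
    · rw [submatrix_apply, submatrix_apply, hσ i, id, id, one_apply_eq, one_mul]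
    · intro k _ hk
      simp [one_apply, hk.symm]
    · simp
  · ext i j
    rw [neg_apply, mul_diagonal, diagonal_mul, submatrix_apply, one_apply]
    split_ifs with h
    · simp [← hd, h]
    · simp

/-- A scalar matrix is a sum of four square-zero matrices as soon as its size vanishes in the
field. -/
theorem Matrix.isSumFourSqZero_smul_one {F : Type*} [Field F] {n : ℕ} {μ : F} (hμ : (n : F) = 0) :
    IsSumFourSqZero (μ • (1 : Matrix (Fin n) (Fin n) F)) := by
  obtain rfl | hn := Nat.eq_zero_or_pos n
  · exact ⟨0, 0, 0, 0, by simp, by simp, by simp, by simp, Subsingleton.elim _ _⟩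
  have of_card {ι : Type} [Fintype ι] [DecidableEq ι] (hι : Fintype.card ι = n)
      (h : IsSumFourSqZero (μ • (1 : Matrix ι ι F))) :
      IsSumFourSqZero (μ • (1 : Matrix (Fin n) (Fin n) F)) := by
    have := h.map (reindexAlgEquiv F F (Fintype.equivFinOfCardEq hι)).toAlgHom.toRingHom
    simpa using this
  by_cases h2 : (2 : F) = 0
  · obtain ⟨m, rfl⟩ : 2 ∣ n := by
      have : CharP F 2 := CharTwo.of_one_ne_zero_of_two_eq_zero one_ne_zero h2
      exact (CharP.cast_eq_zero_iff F 2 n).1 hμ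
    refine of_card (ι := Fin m ⊕ Fin m) (by simp [two_mul]) ?_
    have h22 : (1 : Matrix (Fin m) (Fin m) F) + 1 = 0 := by
      rw [← two_smul F, h2, zero_smul]
    -- The first summand has square zero because `1 + 1 = 0`.
    refine ⟨μ • fromBlocks 1 1 1 1, fromBlocks 0 (-μ • 1) 0 0, fromBlocks 0 0 (-μ • 1) 0, 0,
      ?_, ?_, ?_, by simp, ?_⟩
    · simp [pow_two, fromBlocks_multiply, h22]
    · simp [pow_two, fromBlocks_multiply]
    · simp [pow_two, fromBlocks_multiply]
    · rw [← fromBlocks_one, fromBlocks_smul, fromBlocks_smul]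
      simp [fromBlocks_add]
  · have : NeZero n := ⟨hn.ne'⟩
    -- Reduction modulo the characteristic, which divides `n`.
    let c : ZMod n →+* F := ZMod.castHom (ringChar.dvd hμ) F
    have hsum : μ • (1 : Matrix (ZMod n) (ZMod n) F) =
        diagonal (fun i => μ * c i) + diagonal (fun i => μ - μ * c i) := by
      rw [diagonal_add, smul_one_eq_diagonal]
      simp
    refine of_card (ι := ZMod n) (ZMod.card n) ?_
    rw [hsum]
    refine IsSumTwoSqZero.add
      (isSumTwoSqZero_diagonal h2 (σ := fun i => -i) neg_involutive fun i => by simp)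
      (isSumTwoSqZero_diagonal h2 (σ := fun i => 2 - i) (fun i => sub_sub_cancel 2 i) fun i => ?_)
    rw [map_sub, map_ofNat]
    ring

/-! ### Sums of four square-zero matrices -/

theorem mainTheorem9 {F : Type*} [Field F] (n : ℕ) (A : Matrix (Fin n) (Fin n) F) :
    (∃ S₁ S₂ S₃ S₄ : Matrix (Fin n) (Fin n) F,
        S₁ ^ 2 = 0 ∧ S₂ ^ 2 = 0 ∧ S₃ ^ 2 = 0 ∧ S₄ ^ 2 = 0 ∧ A = S₁ + S₂ + S₃ + S₄) ↔
      A.trace = 0 := by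
  constructor
  · rintro ⟨S₁, S₂, S₃, S₄, h₁, h₂, h₃, h₄, rfl⟩
    have h {S : Matrix (Fin n) (Fin n) F} (hS : S ^ 2 = 0) : S.trace = 0 :=
      (Matrix.isNilpotent_trace_of_isNilpotent ⟨2, hS⟩).eq_zero
    simp [Matrix.trace_add, h h₁, h h₂, h h₃, h h₄]
  · intro htr
    by_cases hA : ∀ μ : F, A ≠ μ • 1
    · obtain ⟨L, U, hL, hU, rfl⟩ := Matrix.isSumTwoNilpotent_of_trace_eq_zero htr (.inr hA)
      exact (Matrix.isSumTwoSqZero_of_isNilpotent hL).add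
        (Matrix.isSumTwoSqZero_of_isNilpotent hU)
    · push Not at hA
      obtain ⟨μ, rfl⟩ := hA
      obtain rfl | hμ := eq_or_ne μ 0
      · exact ⟨0, 0, 0, 0, by simp⟩
      · refine Matrix.isSumFourSqZero_smul_one ?_
        simpa [hμ] using htr
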